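/- **Definitions.** A *cell complex* (cc) is a set $K$ of non-empty subsets (*cells*) of a finite set $S$ with a rank function $\mathrm{rk}:K\to\mathbb N$ whose rank-$0$ cells are exactly the singletons $\{v\}$, $v\in S$ (*vertices*), such that for all $x,y\in K$: (i) $x\subsetneq y$ implies $\mathrm{rk}(x)<\mathrm{rk}(y)$; (ii) $x\cap y\in K\cup\{\emptyset\}$; (iii) if $x\subsetneq y$, there is $z\in K$ with $x\subset z\subset y$ and $\mathrm{rk}(z)=\mathrm{rk}(x)+1$; (iv) if $x\subset y$ and $\mathrm{rk}(y)=\mathrm{rk}(x)+2$, there are exactly two cells $z$ of rank $\mathrm{rk}(x)+1$ with $x\subset z\subset y$. Write $K^{[r]}$ for the set of cells of rank $r$ ($r$-cells; $1$-cells are *edges*), $K^{(k)}=\bigcup_{r\le k}K^{[r]}$ for the $k$-skeleton, $K\cap A=\{x\in K: x\subset A\}$ for the restriction to $A$, $\mathcal E_v$ for the set of edges containing $v$ and $\mathcal E_v^x=\{e\in\mathcal E_v:e\subset x\}$. The *rank* of $K$ is the least $R$ with $K=K^{(R)}$; an $R$-cc is a cc of rank $R$. A *sub-cc* of $K$ is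 a cc $J\subset K$ with the same ranks. A cc is *graph-based* if every edge has exactly two vertices; it is then *connected* if any two vertices are joined by a path of edges, and *local* if it is connected and $K\cap x$ is connected for every cell $x$. A cc of rank $R$ is *closed* if it is graph-based, every maximal cell has rank $R$, and every $(R-1)$-cell lies in exactly two $R$-cells. It is *even* if each connected component of each $2$-cell has an even number of vertices, and *$n$-regular* if it is graph-based and $|\mathcal E_v|=n$ for all vertices $v$. It is *$r$-full* if for every vertex $v$, every $2\le k\le r$ and every $S\subset\mathcal E_v$ with $|S|=k$ there is a $k$-cell $x$ with $\mathcal E_v^x=S$; *full* means $2$-full. An $R$-cc is *simple* if it is closed and, when $R\ge2$, $R$-full. The edges in a connected component $D$ of a $2$-cell of a graph-based cc form a loop through all vertices of $D$. A graph-based cc is *simply connected* if every closed path of edges can be transformed into the empty path by finitely many moves, each move being one of the following or its inverse: replacing a simple subpath $p$ lying in a component $D$ of a $2$-cell by the complementary path $p'$ (the one for which $p$ followed by the inverse of $p'$ runs once around $D$), or deleting an edge that is traversed back and forth. For an edge $\{v,w\}$ of a full graph-based cc, the connection $\nabla_w^v:\mathcal E_v\to\mathcal E_w$ fixes $\{v,w\}$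 and maps any other $e\in\mathcal E_v$ to the edge $f\ne\{v,w\}$ at $w$ contained in the unique $2$-cell containing $e$ and $\{v,w\}$; for a path $p$, $\nabla_p$ is the composition of the connections along its edges. A full graph-based cc is *monodromy-free* if, for every connected component $D$ of a $2$-cell and every loop $l$ running once around $D$ based at some $v\in D$, $\nabla_l$ fixes every edge of $\mathcal E_v$ having exactly one vertex in $D$. Let $K$ be a $2$-cc. For a vertex $v$ and $S\subsetneq\mathcal E_v$ with $|S|\ge2$, an *induced sub-cc* of $K$ at $(v,S)$ is a sub-cc $J$ of $K$ that is an $|S|$-regular, local, even, full, monodromy-free $2$-cc with $J^{[1]}\cap\mathcal E_v=S$. Let $\mathcal C^K_r$ be the set of the vertex sets of all $r$-regular induced sub-cc of $K$. Call $K$ *reconstructible* if it is a local, even, full, monodromy-free, simply connected $2$-cc such that, for all $r\ge2$ and all $x,y\in\mathcal C_r^K$, the restriction $K\cap(x\cap y)$ is connected or empty. The *ambient complex* $K_{amb}$ is given by $K_{amb}^{[r]}=K^{[r]}$ for $0\le r\le2$ and $K_{amb}^{[r]}=\mathcal C_r^K$ for $r\ge3$. **Statement.** Let $L$ be a local, even,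 simply connected, simple $R$-cc with $R\ge3$. Then $L^{(2)}$ is reconstructible and $(L^{(2)})_{amb}=L$ (with the same cells and the same ranks). In particular $L$ is determined by its $2$-skeleton: if $L'$ is any local, even, simply connected, simple cc with $L'^{(2)}=L^{(2)}$, then $L'=L$. -/

import Mathlib

/-- A family of subsets of `V` graded by rank: `K.cells r` is the set of members of rank `r`,
i.e. the preimage of `r` under the rank function of `K`. -/
@[ext]
structure RankedFamily (V : Type*) where
  cells : ℕ → Set (Set V)

namespace RankedFamily

variable {V : Type*}

/-- `x` is a cell of `K` (of some rank). -/
def IsCell (K : RankedFamily V) (x : Set V) : Prop := ∃ r, x ∈ K.cells r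

/-- The vertex set of `K`; vertices `v` are identified with the `0`-cells `{v}`. -/
def vertexSet (K : RankedFamily V) : Set V := {v | {v} ∈ K.cells 0}

/-- (Combinatorial) cell complexes, abbreviated cc. -/
structure IsCellComplex (K : RankedFamily V) : Prop where
  /-- the vertex set is finite -/
  finite_vertexSet : K.vertexSet.Finite
  /-- the `0`-cells are the one-element sets of vertices -/
  zero_cell : ∀ x ∈ K.cells 0, ∃ v, x = {v}
  /-- cells are non-empty ... -/
  nonempty : ∀ x, K.IsCell x → x.Nonempty
  /-- ... sets of vertices -/
  subset_vertexSet : ∀ x, K.IsCell x → x ⊆ K.vertexSet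
  /-- the rank is a function: every cell has only one rank -/
  rank_unique : ∀ x r s, x ∈ K.cells r → x ∈ K.cells s → r = s
  /-- the rank is strictly compatible with inclusion -/
  rank_lt : ∀ x y r s, x ∈ K.cells r → y ∈ K.cells s → x ⊂ y → r < s
  /-- the cells together with the empty set are closed under intersection -/
  inter : ∀ x y, K.IsCell x → K.IsCell y → x ∩ y = ∅ ∨ K.IsCell (x ∩ y)
  /-- no gap: if `x ⊂ y` then `x` is a face of a cell contained in `y` -/
  no_gap : ∀ x y r, x ∈ K.cells r → K.IsCell y → x ⊂ y →
    ∃ z ∈ K.cells (r + 1), x ⊆ z ∧ z ⊆ y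
  /-- the diamond property -/
  diamond : ∀ x y r, x ∈ K.cells r → y ∈ K.cells (r + 2) → x ⊆ y →
    {z | z ∈ K.cells (r + 1) ∧ x ⊆ z ∧ z ⊆ y}.ncard = 2

/-- The rank of `K`: the least `R` such that all cells have rank at most `R`. -/
noncomputable def rank (K : RankedFamily V) : ℕ := sInf {R | ∀ r, R < r → K.cells r = ∅}

/-- The `k`-skeleton: the cells of rank at most `k`. -/
def skeleton (K : RankedFamily V) (k : ℕ) : RankedFamily V where
  cells r := if r ≤ k then K.cells r else ∅

/-- The restriction `K ∩ A`: the cells contained in `A`. -/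
def restrict (K : RankedFamily V) (A : Set V) : RankedFamily V where
  cells r := {x | x ∈ K.cells r ∧ x ⊆ A}

/-- `J` is contained in `K`, with the same ranks. -/
def IsSub (J K : RankedFamily V) : Prop := ∀ r, J.cells r ⊆ K.cells r

/-- Every edge has two vertices. -/
def IsGraphBased (K : RankedFamily V) : Prop := ∀ e ∈ K.cells 1, e.ncard = 2

/-- Every maximal cell has rank `K.rank`. -/
def IsPure (K : RankedFamily V) : Prop :=
  ∀ x, K.IsCell x → (∀ y, K.IsCell y → x ⊆ y → y = x) → x ∈ K.cells K.rank

/-- Graph-based, pure and non-branching. -/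
def IsNonSingular (K : RankedFamily V) : Prop :=
  K.IsGraphBased ∧ K.IsPure ∧
    ∀ r, r + 1 = K.rank → ∀ y ∈ K.cells r, {z | z ∈ K.cells (r + 1) ∧ y ⊆ z}.ncard ≤ 2

/-- Non-singular, and every sub-maximal cell lies in exactly two maximal cells. -/
def IsClosed (K : RankedFamily V) : Prop :=
  K.IsNonSingular ∧
    ∀ r, r + 1 = K.rank → ∀ y ∈ K.cells r, {z | z ∈ K.cells (r + 1) ∧ y ⊆ z}.ncard = 2

/-- The graph formed by the vertices and edges of `K` (elements of `V` that are not vertices of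
`K` are isolated). -/
def graph (K : RankedFamily V) : SimpleGraph V where
  Adj v w := v ≠ w ∧ {v, w} ∈ K.cells 1
  symm := ⟨fun v w h => ⟨h.1.symm, by rw [Set.pair_comm]; exact h.2⟩⟩
  loopless := ⟨fun _ h => h.1 rfl⟩

/-- Graph-based, and any two vertices are linked by a path. -/
def IsConnected (K : RankedFamily V) : Prop :=
  K.IsGraphBased ∧ ∀ v ∈ K.vertexSet, ∀ w ∈ K.vertexSet, K.graph.Reachable v w

/-- Graph-based, and the complex `K ∩ x` is connected for every cell `x`. -/
def IsCellConnected (K : RankedFamily V) : Prop :=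
  K.IsGraphBased ∧ ∀ x, K.IsCell x → (K.restrict x).IsConnected

/-- Connected and cell-connected. -/
def IsLocal (K : RankedFamily V) : Prop := K.IsConnected ∧ K.IsCellConnected

/-- The edges incident to `v`. -/
def edgesAt (K : RankedFamily V) (v : V) : Set (Set V) := {e | e ∈ K.cells 1 ∧ v ∈ e}

/-- The edges incident to `v` and contained in `x`. -/
def edgesAtIn (K : RankedFamily V) (v : V) (x : Set V) : Set (Set V) :=
  {e | e ∈ K.edgesAt v ∧ e ⊆ x}

/-- `n`-regular: every vertex is incident to exactly `n` edges. -/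
def IsRegular (K : RankedFamily V) (n : ℕ) : Prop :=
  K.IsGraphBased ∧ ∀ v ∈ K.vertexSet, (K.edgesAt v).encard = n

/-- `r`-full: for `2 ≤ k ≤ r`, any `k` edges at a vertex `v` are exactly the edges at `v` of some
`k`-cell. -/
def IsRFull (K : RankedFamily V) (r : ℕ) : Prop :=
  ∀ v ∈ K.vertexSet, ∀ k, 2 ≤ k → k ≤ r → ∀ S ⊆ K.edgesAt v, S.encard = k →
    ∃ x ∈ K.cells k, K.edgesAtIn v x = S

/-- Full means `2`-full. -/
def IsFull (K : RankedFamily V) : Prop := K.IsRFull 2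

/-- Simple: closed, and `R`-full where `R` is the rank (if `R ≥ 2`). -/
def IsSimple (K : RankedFamily V) : Prop :=
  K.IsClosed ∧ (2 ≤ K.rank → K.IsRFull K.rank)

/-- `D` is (the vertex set of) a connected component of the cell `C`, i.e. of `K ∩ C`. -/
def IsComponent (K : RankedFamily V) (C D : Set V) : Prop :=
  ∃ v ∈ C, D = {w | w ∈ C ∧ (K.restrict C).graph.Reachable v w}

/-- Every connected component of every `2`-cell has an even number of vertices. -/
def IsEven (K : RankedFamily V) : Prop :=
  ∀ C ∈ K.cells 2, ∀ D, K.IsComponent C D → Even D.ncard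

/-- `l` is one of the two loops based at `v` which run once around the connected component `D`
of a `2`-cell: a simple cycle whose vertices are exactly those of `D`. -/
def IsLoopOf (K : RankedFamily V) (D : Set V) {v : V} (l : K.graph.Walk v v) : Prop :=
  l.IsCycle ∧ {w | w ∈ l.support} = D

/-- Elementary moves of paths. A `2`-cell move replaces a simple path `p` in a `2`-cell by its
complementary path `p'`, the one for which `p` followed by the inverse of `p'` is a loop around
the component of the cell containing `p`. An edge move removes an edge traversed back and
forth. -/
inductive Move (K : RankedFamily V) {v w : V} : K.graph.Walk v w → K.graph.Walk v w → Prop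
  | cell {a b : V} (C D : Set V) (hC : C ∈ K.cells 2) (hD : K.IsComponent C D)
      (p p' : K.graph.Walk a b) (hp : p.IsPath) (hl : K.IsLoopOf D (p.append p'.reverse))
      (q₁ : K.graph.Walk v a) (q₂ : K.graph.Walk b w) :
      Move K (q₁.append (p.append q₂)) (q₁.append (p'.append q₂))
  | edge {a b : V} (h : K.graph.Adj a b)
      (q₁ : K.graph.Walk v a) (q₂ : K.graph.Walk a w) :
      Move K (q₁.append (.cons h (.cons h.symm q₂))) (q₁.append q₂)

/-- Two paths are homotopic if a finite sequence of moves and inverses of moves leads from one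
to the other. -/
def Homotopic (K : RankedFamily V) {v w : V} (p q : K.graph.Walk v w) : Prop :=
  Relation.EqvGen (Move K) p q

/-- Every cycle is contractible (only vertices, edges and `2`-cells play a role). -/
def IsSimplyConnected (K : RankedFamily V) : Prop :=
  K.IsGraphBased ∧ ∀ (v : V) (p : K.graph.Walk v v), K.Homotopic p .nil

/-- The graph of the connection `∇` from `v` to `w`, for an edge `{v, w}`, as a relation between
edges at `v` and edges at `w`: it maps `{v, w}` to itself, and any other edge `e` at `v` to the
other edge `f` at `w` contained in the `2`-cell containing `e` and `{v, w}`. -/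
def Nabla (K : RankedFamily V) (v w : V) (e f : Set V) : Prop :=
  (e = {v, w} ∧ f = {v, w}) ∨
  (e ∈ K.edgesAt v ∧ e ≠ {v, w} ∧ f ∈ K.edgesAt w ∧ f ≠ {v, w} ∧
    ∃ C ∈ K.cells 2, {v, w} ⊆ C ∧ e ⊆ C ∧ f ⊆ C)

/-- The connection along a path, as a relation: `K.NablaPath p e f` means `∇_p e = f`. -/
def NablaPath (K : RankedFamily V) : {v w : V} → K.graph.Walk v w → Set V → Set V → Prop
  | _, _, .nil, e, f => e = f
  | v, _, .cons (v := u) _ p, e, f => ∃ g, K.Nabla v u e g ∧ K.NablaPath p g f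

/-- The edges with exactly one vertex in `D`. -/
def edgesLeaving (K : RankedFamily V) (D : Set V) : Set (Set V) :=
  {e | e ∈ K.cells 1 ∧ (e ∩ D).ncard = 1}

/-- Monodromy-free: the connection along any loop `l` around a connected component `D` of a
`2`-cell fixes every edge leaving `D` at the base vertex of `l`. -/
def IsMonodromyFree (K : RankedFamily V) : Prop :=
  ∀ C ∈ K.cells 2, ∀ D, K.IsComponent C D → ∀ (v : V) (l : K.graph.Walk v v), K.IsLoopOf D l →
    ∀ e ∈ K.edgesAt v ∩ K.edgesLeaving D, K.NablaPath l e e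

/-- `J` is the induced sub-cell complex `J(v, S)` of `K`. -/
structure IsInduced (K : RankedFamily V) (v : V) (S : Set (Set V)) (J : RankedFamily V) :
    Prop where
  vertex : v ∈ K.vertexSet
  ssubset : S ⊂ K.edgesAt v
  two_le : 2 ≤ S.encard
  isCellComplex : J.IsCellComplex
  isSub : J.IsSub K
  rank_eq : J.rank = 2
  isRegular : J.IsRegular S.ncard
  isLocal : J.IsLocal
  isEven : J.IsEven
  isFull : J.IsFull
  isMonodromyFree : J.IsMonodromyFree
  edges_eq : J.cells 1 ∩ K.edgesAt v = S

/-- The induced `r`-cells of `K`: the vertex sets of the `r`-regular induced sub-cell complexes. -/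
def inducedCells (K : RankedFamily V) (r : ℕ) : Set (Set V) :=
  {A | ∃ v S J, K.IsInduced v S J ∧ J.IsRegular r ∧ A = J.vertexSet}

/-- A collection `𝒞` of sets of vertices is non-singular if `K ∩ (x ∩ y)` is connected or empty
for all `x, y ∈ 𝒞`. -/
def IsNonSingularCollection (K : RankedFamily V) (𝒞 : Set (Set V)) : Prop :=
  ∀ x ∈ 𝒞, ∀ y ∈ 𝒞, x ∩ y = ∅ ∨ (K.restrict (x ∩ y)).IsConnected

/-- The hypotheses under which the ambient complex of a `2`-complex is formed. -/
structure IsReconstructible (K : RankedFamily V) : Prop where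
  isCellComplex : K.IsCellComplex
  rank_eq : K.rank = 2
  isLocal : K.IsLocal
  isEven : K.IsEven
  isFull : K.IsFull
  isMonodromyFree : K.IsMonodromyFree
  isSimplyConnected : K.IsSimplyConnected
  nonSingular : ∀ r, 2 ≤ r → K.IsNonSingularCollection (K.inducedCells r)

/-- The ambient complex of a `2`-complex `K`: its cells of rank at most `2` are those of `K`, its
`r`-cells for `r ≥ 3` are the induced `r`-cells of `K`. -/
def ambient (K : RankedFamily V) : RankedFamily V where
  cells r := if r ≤ 2 then K.cells r else K.inducedCells r

end RankedFamily

/-! Around a vertex, the cells of $L$ are governed by sets of edges. The diamond property shows that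
a cell is determined by its edges at any one of its vertices (`exists_edge_not_subset`,
`subset_of_edgesAtIn_subset`). With fullness, an $r$-cell has exactly $r$ edges at each of its
vertices when $r\ge1$, and closedness gives every vertex degree $R+1$ (`ncard_edgesAt_of_isSimple`).
Hence the cells of rank at least $2$ through $v$ correspond to the proper subsets of $\mathcal E_v$
with at least two elements.

It remains to compare cells with induced sub-complexes. The $2$-skeleton of a cell is induced; its
monodromy is trivial because a $2$-cell and an edge leaving it span a $3$-cell, which has no other
edge leaving the $2$-cell at that vertex. Conversely, for $J$ induced at $(v,S)$, let $x$ be the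
cell spanned by $S$. Agreement of the edges of $J$ and $x$ at one vertex spreads to its neighbours
through $2$-cells, and connectedness of $J$ and of $x$ makes the vertex set of $J$ equal to $x$.

Thus $\mathcal C_r=L^{[r]}$ for $r\ge2$ (`inducedCells_skeleton_two`), from which the ambient
complex is read off. Non-singularity holds because two cells meet in a cell or not at all, and cells
are connected. -/

namespace RankedFamily

variable {V : Type*} {K J : RankedFamily V}

/-! ### Cells and their edges at a vertex -/

theorem edgesAtIn_mono (K : RankedFamily V) (v : V) {x y : Set V} (h : x ⊆ y) :
    K.edgesAtIn v x ⊆ K.edgesAtIn v y := fun _ he => ⟨he.1, he.2.trans h⟩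

theorem mem_of_edgesAtIn_eq {x : Set V} {v : V} {S : Set (Set V)} {k : ℕ}
    (hS : S.encard = k) (hk : k ≠ 0) (h : K.edgesAtIn v x = S) : v ∈ x := by
  have : S.Nonempty := by
    rw [← Set.encard_ne_zero, hS]; exact_mod_cast hk
  obtain ⟨e, he⟩ := this
  rw [← h] at he
  exact he.2 he.1.2

theorem rank_eq_of_forall {n : ℕ} (hne : (K.cells n).Nonempty)
    (h : ∀ r, n < r → K.cells r = ∅) : K.rank = n := by
  refine le_antisymm (Nat.sInf_le h) (le_csInf ⟨n, h⟩ fun m hm => ?_)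
  by_contra! hlt
  exact hne.ne_empty (hm n hlt)

namespace IsCellComplex

variable (hK : K.IsCellComplex)
include hK

theorem singleton_mem {x : Set V} (hx : K.IsCell x) {v : V} (hv : v ∈ x) : {v} ∈ K.cells 0 :=
  hK.subset_vertexSet x hx hv

theorem eq_of_subset {x y : Set V} {r : ℕ} (hx : x ∈ K.cells r) (hy : y ∈ K.cells r)
    (h : x ⊆ y) : x = y := by
  by_contra hne
  exact (hK.rank_lt x y r r hx hy (h.ssubset_of_ne hne)).false

theorem exists_between {x y : Set V} {r s t : ℕ} (hx : x ∈ K.cells r) (hy : y ∈ K.cells s)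
    (hxy : x ⊆ y) (hrt : r ≤ t) (hts : t ≤ s) : ∃ z ∈ K.cells t, x ⊆ z ∧ z ⊆ y := by
  induction t, hrt using Nat.le_induction with
  | base => exact ⟨x, hx, subset_rfl, hxy⟩
  | succ t _ ih =>
    obtain ⟨z, hz, hxz, hzy⟩ := ih (by omega)
    have hne : z ≠ y := by
      rintro rfl
      have := hK.rank_unique z t s hz hy
      omega
    obtain ⟨w, hw, hzw, hwy⟩ := hK.no_gap z y t hz ⟨s, hy⟩ (hzy.ssubset_of_ne hne)
    exact ⟨w, hw, hxz.trans hzw, hwy⟩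

theorem inter_isCell {x y : Set V} (hx : K.IsCell x) (hy : K.IsCell y) {v : V} (hvx : v ∈ x)
    (hvy : v ∈ y) : K.IsCell (x ∩ y) := by
  rcases hK.inter x y hx hy with h | h
  · exact absurd h (Set.Nonempty.ne_empty ⟨v, hvx, hvy⟩)
  · exact h

/-- A cell has an edge at `v` outside any given proper face that contains `v`. -/
theorem exists_edge_not_subset {x y : Set V} {v : V} (hx : K.IsCell x) (hy : K.IsCell y)
    (hv : v ∈ y) (hyx : y ⊂ x) : ∃ e ∈ K.edgesAtIn v x, ¬ e ⊆ y := by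
  obtain ⟨k, hk⟩ := hx
  induction k using Nat.strong_induction_on generalizing x y with
  | _ k ih =>
    obtain ⟨s, hs⟩ := hy
    have hsk := hK.rank_lt y x s k hs hk hyx
    -- Enlarging $y$ to a face of corank one only strengthens the claim.
    obtain ⟨z, hz, hyz, hzx⟩ := hK.exists_between hs hk hyx.subset (t := k - 1)
      (by omega) (by omega)
    have hvz := hyz hv
    have hzne : ¬ x ⊆ z := fun h => by
      have := hK.rank_unique x k (k - 1) hk (hzx.antisymm h ▸ hz)
      omega
    suffices h : ∃ e ∈ K.edgesAtIn v x, ¬ e ⊆ z by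
      obtain ⟨e, he, hez⟩ := h
      exact ⟨e, he, fun h => hez (h.trans hyz)⟩
    have hv0 := hK.singleton_mem ⟨_, hz⟩ hvz
    rcases Nat.lt_or_ge k 2 with h2 | h2
    · obtain rfl : k = 1 := by omega
      exact ⟨x, ⟨⟨hk, hzx hvz⟩, subset_rfl⟩, hzne⟩
    · obtain ⟨k, rfl⟩ := Nat.exists_eq_add_of_le' h2
      obtain ⟨w, hw, hvw, hwz⟩ := hK.exists_between hv0 hz (Set.singleton_subset_iff.2 hvz)
        (t := k) (by omega) (by omega)
      -- The diamond over a face $w\ni v$ of corank two yields a second facet $z'$ of $x$. By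
      -- induction $z'$ has an edge at $v$ outside $z\cap z'$, hence outside $z$.
      have hd := hK.diamond w x k hw hk (hwz.trans hzx)
      obtain ⟨z', hz', hne⟩ := Set.exists_ne_of_one_lt_ncard (by rw [hd]; norm_num) z
      have hvz' : v ∈ z' := hz'.2.1 (hvw rfl)
      obtain ⟨e, he, hez⟩ := ih (k + 1) (by omega) (x := z') (y := z ∩ z')
        (hK.inter_isCell ⟨_, hz⟩ ⟨_, hz'.1⟩ hvz hvz') ⟨hvz, hvz'⟩
        (Set.inter_subset_right.ssubset_of_ne fun h =>
          hne (hK.eq_of_subset hz'.1 hz (h ▸ Set.inter_subset_left))) hz'.1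
      exact ⟨e, edgesAtIn_mono K v hz'.2.2 he, fun h => hez (Set.subset_inter h he.2)⟩

/-- Otherwise $x\cap y$ would be a proper face of $x$ through $v$ containing all edges of $x$ at
$v$. -/
theorem subset_of_edgesAtIn_subset {x y : Set V} {v : V} (hx : K.IsCell x) (hy : K.IsCell y)
    (hvx : v ∈ x) (hvy : v ∈ y) (h : ∀ e ∈ K.edgesAtIn v x, e ⊆ y) : x ⊆ y := by
  by_contra hxy
  obtain ⟨e, he, hne⟩ := hK.exists_edge_not_subset hx (hK.inter_isCell hx hy hvx hvy) ⟨hvx, hvy⟩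
    (Set.inter_subset_left.ssubset_of_ne fun h => hxy (h ▸ Set.inter_subset_right))
  exact hne (Set.subset_inter he.2 (h e he))

theorem setOf_isCell_finite : {x | K.IsCell x}.Finite :=
  hK.finite_vertexSet.finite_subsets.subset fun x hx => hK.subset_vertexSet x hx

theorem edgesAt_finite (v : V) : (K.edgesAt v).Finite :=
  hK.setOf_isCell_finite.subset fun _ he => ⟨1, he.1⟩

theorem edgesAtIn_finite (v : V) (x : Set V) : (K.edgesAtIn v x).Finite :=
  (hK.edgesAt_finite v).subset fun _ he => he.1

/-- Each step up a chain of faces through $v$ adds at least one edge at $v$. -/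
theorem le_ncard_edgesAtIn {x : Set V} {v : V} {r : ℕ} (hx : x ∈ K.cells r) (hv : v ∈ x) :
    r ≤ (K.edgesAtIn v x).ncard := by
  induction r generalizing x with
  | zero => exact Nat.zero_le _
  | succ r ih =>
    obtain ⟨z, hz, hvz, hzx⟩ := hK.exists_between (hK.singleton_mem ⟨_, hx⟩ hv) hx
      (Set.singleton_subset_iff.2 hv) (Nat.zero_le r) (Nat.le_succ r)
    have hne : z ≠ x := by
      rintro rfl
      have := hK.rank_unique z _ _ hz hx
      omega
    obtain ⟨e, he, hez⟩ := hK.exists_edge_not_subset ⟨_, hx⟩ ⟨_, hz⟩ (hvz rfl)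
      (hzx.ssubset_of_ne hne)
    refine (ih hz (hvz rfl)).trans_lt (Set.ncard_lt_ncard ?_ (hK.edgesAtIn_finite v x))
    exact (edgesAtIn_mono K v hzx).ssubset_of_ne fun h => hez (h ▸ he).2

theorem cells_eq_empty_of_rank_lt {r : ℕ} (hr : K.rank < r) : K.cells r = ∅ := by
  -- The infimum defining the rank is attained only if ranks are bounded; the total number of cells
  -- bounds them, since an $r$-cell has at least $r$ edges at a vertex.
  have : {R | ∀ r, R < r → K.cells r = ∅}.Nonempty := by
    refine ⟨{x | K.IsCell x}.ncard, fun r hr => ?_⟩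
    by_contra hne
    obtain ⟨x, hx⟩ := Set.nonempty_iff_ne_empty.2 hne
    obtain ⟨v, hv⟩ := hK.nonempty x ⟨r, hx⟩
    have h1 := hK.le_ncard_edgesAtIn hx hv
    have h2 : (K.edgesAtIn v x).ncard ≤ {x | K.IsCell x}.ncard :=
      Set.ncard_le_ncard (fun e he => ⟨1, he.1.1⟩) hK.setOf_isCell_finite
    omega
  exact Nat.sInf_mem this r hr

theorem le_rank {x : Set V} {r : ℕ} (hx : x ∈ K.cells r) : r ≤ K.rank := by
  by_contra! h
  exact (hK.cells_eq_empty_of_rank_lt h ▸ hx : x ∈ (∅ : Set (Set V)))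

/-- The shift to $k+1$ excludes the empty complex, which has rank $0$ but no $0$-cell. -/
theorem cells_nonempty_of_le_rank {k : ℕ} (hk : k + 1 ≤ K.rank) : (K.cells (k + 1)).Nonempty := by
  have h := Nat.notMem_of_lt_sInf (Nat.lt_of_succ_le hk)
  simp only [Set.mem_ofPred_eq, not_forall] at h
  obtain ⟨r, hr, hne⟩ := h
  obtain ⟨x, hx⟩ := Set.nonempty_iff_ne_empty.2 hne
  obtain ⟨v, hv⟩ := hK.nonempty x ⟨r, hx⟩
  obtain ⟨z, hz, -⟩ := hK.exists_between (hK.singleton_mem ⟨_, hx⟩ hv) hx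
    (Set.singleton_subset_iff.2 hv) (Nat.zero_le (k + 1)) hr
  exact ⟨z, hz⟩

/-- Any $r$ of the edges of $x$ at $v$ span an $r$-cell, by fullness. It lies in $x$ and has the
same rank, so it is $x$. Fullness says nothing below rank $2$, so edges are treated apart. -/
theorem ncard_edgesAtIn {n r : ℕ} (hf : K.IsRFull n) {x : Set V} {v : V}
    (hx : x ∈ K.cells r) (hv : v ∈ x) (hr : 1 ≤ r) (hrn : r ≤ n) :
    (K.edgesAtIn v x).ncard = r := by
  rcases Nat.lt_or_ge r 2 with h2 | h2
  · obtain rfl : r = 1 := by omega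
    rw [Set.ncard_eq_one]
    refine ⟨x, Set.eq_singleton_iff_unique_mem.2 ⟨⟨⟨hx, hv⟩, subset_rfl⟩, fun e he => ?_⟩⟩
    exact hK.eq_of_subset he.1.1 hx he.2
  · obtain ⟨T, hT, hTr⟩ := Set.exists_subset_card_eq (hK.le_ncard_edgesAtIn hx hv)
    have hTfin : T.Finite := (hK.edgesAtIn_finite v x).subset hT
    have hTe : T.encard = r := by rw [← hTfin.cast_ncard_eq, hTr]
    obtain ⟨z, hz, hzT⟩ := hf v (hK.subset_vertexSet x ⟨r, hx⟩ hv) r h2 hrn T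
      (fun e he => (hT he).1) hTe
    have hvz := mem_of_edgesAtIn_eq hTe (by omega) hzT
    have hzx := hK.subset_of_edgesAtIn_subset ⟨r, hz⟩ ⟨r, hx⟩ hvz hv
      (fun e he => (hT (hzT ▸ he)).2)
    rw [← hK.eq_of_subset hz hx hzx, hzT, hTr]

/-- In a full complex, `S` determines a cell at `v` of rank `|S|`. -/
theorem exists_cell {n : ℕ} (hf : K.IsRFull n) {v : V} (hv : v ∈ K.vertexSet) {S : Set (Set V)}
    (hS : S ⊆ K.edgesAt v) (h2 : 2 ≤ S.ncard) (hn : S.ncard ≤ n) :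
    ∃ x ∈ K.cells S.ncard, v ∈ x ∧ K.edgesAtIn v x = S := by
  have hfin := (hK.edgesAt_finite v).subset hS
  obtain ⟨x, hx, h⟩ := hf v hv _ h2 hn S hS hfin.cast_ncard_eq.symm
  exact ⟨x, hx, mem_of_edgesAtIn_eq (k := S.ncard)
    hfin.cast_ncard_eq.symm (by omega) h, h⟩

theorem exists_cell_pair {n : ℕ} (hf : K.IsRFull n) (hn : 2 ≤ n) {v : V} (hv : v ∈ K.vertexSet)
    {e f : Set V} (he : e ∈ K.edgesAt v) (hfe : f ∈ K.edgesAt v) (hne : e ≠ f) :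
    ∃ x ∈ K.cells 2, v ∈ x ∧ K.edgesAtIn v x = {e, f} := by
  have h2 : ({e, f} : Set (Set V)).ncard = 2 := Set.ncard_pair hne
  have := hK.exists_cell hf hv (Set.pair_subset he hfe) h2.ge (h2.trans_le hn)
  rwa [h2] at this

theorem exists_other_edge {n : ℕ} (hf : K.IsRFull n) (hn : 2 ≤ n) {C e : Set V} {v : V}
    (hC : C ∈ K.cells 2) (he : e ∈ K.edgesAtIn v C) :
    ∃ f, f ≠ e ∧ K.edgesAtIn v C = {e, f} := by
  have h2 := hK.ncard_edgesAtIn hf hC (he.2 he.1.2) (by norm_num) hn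
  obtain ⟨f, hfC, hfe⟩ := Set.exists_ne_of_one_lt_ncard (h2 ▸ one_lt_two) e
  refine ⟨f, hfe, (Set.eq_of_subset_of_ncard_le (Set.pair_subset he hfC) ?_
    (hK.edgesAtIn_finite v C)).symm⟩
  rw [h2, Set.ncard_pair hfe.symm]

/-- The cofaces of a cell `y ∋ v` correspond to the edges at `v` not contained in `y`. -/
theorem ncard_cofaces {n r : ℕ} (hf : K.IsRFull n) {y : Set V} {v : V} (hy : y ∈ K.cells r)
    (hv : v ∈ y) (hr : 1 ≤ r) (hrn : r + 1 ≤ n) :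
    {z | z ∈ K.cells (r + 1) ∧ y ⊆ z}.ncard + r = (K.edgesAt v).ncard := by
  have hyn := hK.ncard_edgesAtIn hf hy hv hr (by omega)
  have hsub : K.edgesAtIn v y ⊆ K.edgesAt v := fun e he => he.1
  have hvK := hK.subset_vertexSet y ⟨r, hy⟩ hv
  have hins : ∀ e ∈ K.edgesAt v \ K.edgesAtIn v y, ∃ z ∈ K.cells (r + 1), v ∈ z ∧
      K.edgesAtIn v z = insert e (K.edgesAtIn v y) := by
    intro e he
    have hc : (insert e (K.edgesAtIn v y)).ncard = r + 1 := by
      rw [Set.ncard_insert_of_notMem he.2 (hK.edgesAtIn_finite v y), hyn]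
    have := hK.exists_cell hf hvK (Set.insert_subset he.1 hsub) (by omega) (by omega)
    rwa [hc] at this
  choose! g hg hvg hgE using hins
  have hbij : (K.edgesAt v \ K.edgesAtIn v y).ncard = {z | z ∈ K.cells (r + 1) ∧ y ⊆ z}.ncard := by
    refine Set.ncard_congr (fun e _ => g e) (fun e he => ⟨hg e he, ?_⟩) ?_ ?_
    · refine hK.subset_of_edgesAtIn_subset ⟨r, hy⟩ ⟨_, hg e he⟩ hv (hvg e he) fun f hfy => ?_
      have : f ∈ K.edgesAtIn v (g e) := by rw [hgE e he]; exact Or.inr hfy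
      exact this.2
    · intro e f he hfe h
      have h' : e ∈ insert f (K.edgesAtIn v y) := by
        rw [← hgE f hfe, ← h, hgE e he]; exact Set.mem_insert _ _
      exact h'.resolve_right he.2
    -- Surjectivity: a coface has $r+1$ edges at $v$, so one lies outside $y$, and with the edges of
    -- $y$ it spans that coface.
    · rintro z ⟨hz, hyz⟩
      have hzn := hK.ncard_edgesAtIn hf hz (hyz hv) (by omega) hrn
      obtain ⟨e, hez, hey⟩ := Set.exists_mem_notMem_of_ncard_lt_ncard (hyn.trans_lt (by omega :
        r < (K.edgesAtIn v z).ncard)) (hK.edgesAtIn_finite v y)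
      have he : e ∈ K.edgesAt v \ K.edgesAtIn v y := ⟨hez.1, hey⟩
      refine ⟨e, he, hK.eq_of_subset (hg e he) hz ?_⟩
      refine hK.subset_of_edgesAtIn_subset ⟨_, hg e he⟩ ⟨_, hz⟩ (hvg e he) (hyz hv) ?_
      rw [hgE e he]
      rintro f (rfl | hfy)
      · exact hez.2
      · exact hfy.2.trans hyz
  rw [← hbij, ← hyn]
  exact Set.ncard_sdiff_add_ncard_of_subset hsub (hK.edgesAt_finite v)

/-- An $(R-1)$-cell through $v$ has exactly two cofaces, so `ncard_cofaces` gives degree $2+(R-1)$.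
-/
theorem ncard_edgesAt_of_isSimple (hs : K.IsSimple) (hR : 2 ≤ K.rank) {v : V}
    (hv : v ∈ K.vertexSet) : (K.edgesAt v).ncard = K.rank + 1 := by
  obtain ⟨x, hvx, hmax⟩ := hK.setOf_isCell_finite.exists_le_maximal (a := {v}) ⟨0, hv⟩
  have hx := hs.1.1.2.1 x hmax.1 fun y hy hxy => (hmax.eq_of_subset hy hxy).symm
  obtain ⟨r, hr⟩ := Nat.exists_eq_add_of_le' (show 1 ≤ K.rank by omega)
  obtain ⟨y, hy, hvy, -⟩ := hK.exists_between hv hx hvx (Nat.zero_le r) (by omega)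
  have h := hK.ncard_cofaces (hs.2 hR) hy (hvy rfl) (by omega) hr.ge
  rw [hs.1.2 r hr.symm y hy] at h
  omega

end IsCellComplex

/-! ### The two-skeleton inside a set of vertices -/

theorem cells_restrict (K : RankedFamily V) (A : Set V) (r : ℕ) :
    (K.restrict A).cells r = {x | x ∈ K.cells r ∧ x ⊆ A} := rfl

theorem cells_skeleton {k r : ℕ} (K : RankedFamily V) (h : r ≤ k) :
    (K.skeleton k).cells r = K.cells r := if_pos h

theorem cells_skeleton_of_lt {k r : ℕ} (K : RankedFamily V) (h : k < r) :
    (K.skeleton k).cells r = ∅ := if_neg h.not_ge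

theorem skeleton_isSub (K : RankedFamily V) (k : ℕ) : (K.skeleton k).IsSub K := by
  intro r x hx
  rcases le_or_gt r k with h | h
  · rwa [K.cells_skeleton h] at hx
  · rw [K.cells_skeleton_of_lt h] at hx
    exact hx.elim

theorem restrict_univ (K : RankedFamily V) : K.restrict Set.univ = K := by
  ext r x
  simp [cells_restrict]

theorem graph_congr (h : J.cells 1 = K.cells 1) : J.graph = K.graph := by
  ext v w
  simp only [graph, h]

theorem IsSub.isCell (h : J.IsSub K) {x : Set V} (hx : J.IsCell x) : K.IsCell x :=
  hx.imp fun r hr => h r hr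

theorem IsSub.isGraphBased (h : J.IsSub K) (hK : K.IsGraphBased) : J.IsGraphBased :=
  fun e he => hK e (h 1 he)

theorem IsConnected.congr (h0 : J.cells 0 = K.cells 0) (h1 : J.cells 1 = K.cells 1)
    (hK : K.IsConnected) : J.IsConnected := by
  refine ⟨fun e he => hK.1 e (h1 ▸ he), fun v hv w hw => ?_⟩
  rw [graph_congr h1]
  exact hK.2 v (h0 ▸ hv : {v} ∈ K.cells 0) w (h0 ▸ hw : {w} ∈ K.cells 0)

/-- The `2`-skeleton of the part of `K` lying in `A`. -/
def twoSkeletonIn (K : RankedFamily V) (A : Set V) : RankedFamily V := (K.skeleton 2).restrict A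

theorem mem_twoSkeletonIn {A x : Set V} {r : ℕ} :
    x ∈ (K.twoSkeletonIn A).cells r ↔ r ≤ 2 ∧ x ∈ K.cells r ∧ x ⊆ A := by
  rcases le_or_gt r 2 with h | h
  · simp [twoSkeletonIn, cells_restrict, cells_skeleton K h, h]
  · simp [twoSkeletonIn, cells_restrict, cells_skeleton_of_lt K h, h.not_ge]

theorem twoSkeletonIn_univ : K.twoSkeletonIn Set.univ = K.skeleton 2 := restrict_univ _

theorem twoSkeletonIn_isSub (A : Set V) : (K.twoSkeletonIn A).IsSub K :=
  fun _ _ hx => (mem_twoSkeletonIn.1 hx).2.1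

theorem twoSkeletonIn_isSub_skeleton (A : Set V) : (K.twoSkeletonIn A).IsSub (K.skeleton 2) :=
  fun _ _ hx => hx.1

theorem vertexSet_twoSkeletonIn (A : Set V) :
    (K.twoSkeletonIn A).vertexSet = K.vertexSet ∩ A := by
  ext v
  simp [vertexSet, mem_twoSkeletonIn]

theorem edgesAt_twoSkeletonIn (A : Set V) (v : V) :
    (K.twoSkeletonIn A).edgesAt v = K.edgesAtIn v A := by
  ext e
  simp only [edgesAtIn, edgesAt, Set.mem_ofPred_eq, mem_twoSkeletonIn]
  exact ⟨fun h => ⟨⟨h.1.2.1, h.2⟩, h.1.2.2⟩, fun h => ⟨⟨by norm_num, h.1.1, h.2⟩, h.1.2⟩⟩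

theorem edgesAt_skeleton_two (v : V) : (K.skeleton 2).edgesAt v = K.edgesAt v := by
  simp [edgesAt, cells_skeleton K (show 1 ≤ 2 by norm_num)]

theorem cells_restrict_twoSkeletonIn {A C : Set V} (hCA : C ⊆ A) {r : ℕ} (hr : r ≤ 2) :
    ((K.twoSkeletonIn A).restrict C).cells r = (K.restrict C).cells r := by
  ext x
  simp only [cells_restrict, Set.mem_ofPred_eq, mem_twoSkeletonIn]
  exact ⟨fun h => ⟨h.1.2.1, h.2⟩, fun h => ⟨⟨hr, h.1, h.2.trans hCA⟩, h.2⟩⟩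

theorem isComponent_twoSkeletonIn {A C D : Set V} (hCA : C ⊆ A) :
    (K.twoSkeletonIn A).IsComponent C D ↔ K.IsComponent C D := by
  unfold IsComponent
  rw [graph_congr (cells_restrict_twoSkeletonIn hCA (r := 1) (by norm_num))]

theorem IsComponent.eq_cell (hK : K.IsCellComplex) (hc : K.IsCellConnected) {C D : Set V}
    (hC : K.IsCell C) (h : K.IsComponent C D) : D = C := by
  obtain ⟨v, hv, rfl⟩ := h
  have hmem : ∀ w ∈ C, w ∈ (K.restrict C).vertexSet := fun w hw =>
    ⟨hK.singleton_mem hC hw, Set.singleton_subset_iff.2 hw⟩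
  exact Set.Subset.antisymm (fun w hw => hw.1)
    fun w hw => ⟨hw, (hc.2 C hC).2 v (hmem v hv) w (hmem w hw)⟩

theorem IsCellComplex.twoSkeletonIn (hK : K.IsCellComplex) (A : Set V) :
    (K.twoSkeletonIn A).IsCellComplex where
  finite_vertexSet := hK.finite_vertexSet.subset fun v hv => (mem_twoSkeletonIn.1 hv).2.1
  zero_cell x hx := hK.zero_cell x (mem_twoSkeletonIn.1 hx).2.1
  nonempty x hx := hK.nonempty x ((twoSkeletonIn_isSub A).isCell hx)
  subset_vertexSet x hx v hv := by
    have hxK := (twoSkeletonIn_isSub A).isCell hx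
    obtain ⟨r, hx⟩ := hx
    exact mem_twoSkeletonIn.2 ⟨by norm_num, hK.singleton_mem hxK hv,
      Set.singleton_subset_iff.2 ((mem_twoSkeletonIn.1 hx).2.2 hv)⟩
  rank_unique x r s hr hs :=
    hK.rank_unique x r s (mem_twoSkeletonIn.1 hr).2.1 (mem_twoSkeletonIn.1 hs).2.1
  rank_lt x y r s hr hs :=
    hK.rank_lt x y r s (mem_twoSkeletonIn.1 hr).2.1 (mem_twoSkeletonIn.1 hs).2.1
  inter x y hx hy := by
    rcases hK.inter x y ((twoSkeletonIn_isSub A).isCell hx) ((twoSkeletonIn_isSub A).isCell hy)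
      with h | ⟨t, ht⟩
    · exact Or.inl h
    · obtain ⟨r, hx⟩ := hx
      rw [mem_twoSkeletonIn] at hx
      refine Or.inr ⟨t, mem_twoSkeletonIn.2 ⟨?_, ht, Set.inter_subset_left.trans hx.2.2⟩⟩
      rcases (Set.inter_subset_left : x ∩ y ⊆ x).eq_or_ssubset with h | h
      · rw [hK.rank_unique x t r (h ▸ ht) hx.2.1]
        exact hx.1
      · exact (hK.rank_lt _ _ _ _ ht hx.2.1 h).le.trans hx.1
  no_gap x y r hx hy hxy := by
    obtain ⟨s, hy⟩ := hy
    rw [mem_twoSkeletonIn] at hx hy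
    obtain ⟨z, hz, hxz, hzy⟩ := hK.no_gap x y r hx.2.1 ⟨s, hy.2.1⟩ hxy
    have := hK.rank_lt x y r s hx.2.1 hy.2.1 hxy
    exact ⟨z, mem_twoSkeletonIn.2 ⟨by omega, hz, hzy.trans hy.2.2⟩, hxz, hzy⟩
  diamond x y r hx hy hxy := by
    rw [mem_twoSkeletonIn] at hx hy
    rw [← hK.diamond x y r hx.2.1 hy.2.1 hxy]
    congr 1
    ext z
    simp only [Set.mem_ofPred_eq, mem_twoSkeletonIn]
    exact ⟨fun h => ⟨h.1.2.1, h.2⟩, fun h => ⟨⟨by omega, h.1, h.2.2.trans hy.2.2⟩, h.2⟩⟩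

/-- `A` contains every cell of which it contains the edges at some vertex. -/
def IsEdgeClosed (K : RankedFamily V) (A : Set V) : Prop :=
  ∀ v ∈ A, ∀ y, K.IsCell y → v ∈ y → (∀ e ∈ K.edgesAtIn v y, e ⊆ A) → y ⊆ A

/-- Edge-closedness covers two uses at once: `Set.univ` for the whole $2$-skeleton, and a single
cell for its induced sub-complex. -/
theorem isEdgeClosed_univ : K.IsEdgeClosed Set.univ := fun _ _ y _ _ _ => y.subset_univ

theorem IsCellComplex.isEdgeClosed (hK : K.IsCellComplex) {x : Set V} (hx : K.IsCell x) :
    K.IsEdgeClosed x := fun _ hv _ hy hvy h => hK.subset_of_edgesAtIn_subset hy hx hvy hv h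

/-! ### Evenness, connectedness, fullness and monodromy of two-skeleta -/

theorem IsEven.twoSkeletonIn (h : K.IsEven) (A : Set V) : (K.twoSkeletonIn A).IsEven := by
  intro C hC D hD
  rw [mem_twoSkeletonIn] at hC
  exact h C hC.2.1 D ((isComponent_twoSkeletonIn hC.2.2).1 hD)

theorem IsCellConnected.twoSkeletonIn (h : K.IsCellConnected) (A : Set V) :
    (K.twoSkeletonIn A).IsCellConnected := by
  refine ⟨(twoSkeletonIn_isSub A).isGraphBased h.1, fun x hx => ?_⟩
  have hxK := h.2 x ((twoSkeletonIn_isSub A).isCell hx)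
  obtain ⟨r, hx⟩ := hx
  have hxA := (mem_twoSkeletonIn.1 hx).2.2
  exact hxK.congr (cells_restrict_twoSkeletonIn hxA (by norm_num))
    (cells_restrict_twoSkeletonIn hxA (by norm_num))

theorem IsConnected.twoSkeletonIn {A : Set V} (h : (K.restrict A).IsConnected) :
    (K.twoSkeletonIn A).IsConnected := by
  refine h.congr ?_ ?_ <;> ext x <;> simp [mem_twoSkeletonIn, cells_restrict]

theorem IsRFull.isFull_twoSkeletonIn {n : ℕ} (hf : K.IsRFull n)
    (hn : 2 ≤ n) {A : Set V} (hA : K.IsEdgeClosed A) : (K.twoSkeletonIn A).IsFull := by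
  intro v hv k hk hk2 S hS hSk
  obtain rfl : k = 2 := le_antisymm hk2 hk
  rw [vertexSet_twoSkeletonIn] at hv
  rw [edgesAt_twoSkeletonIn] at hS
  obtain ⟨x, hx, hxS⟩ := hf v hv.1 2 le_rfl hn S (fun e he => (hS he).1) hSk
  have hvx := mem_of_edgesAtIn_eq hSk (by norm_num) hxS
  have hxA : x ⊆ A := hA v hv.2 x ⟨2, hx⟩ hvx fun e he => (hS (hxS ▸ he)).2
  refine ⟨x, mem_twoSkeletonIn.2 ⟨le_rfl, hx, hxA⟩, ?_⟩
  rw [← hxS, edgesAtIn, edgesAt_twoSkeletonIn]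
  ext e
  exact ⟨fun h => ⟨h.1.1, h.2⟩, fun h => ⟨⟨h.1, h.2.trans hxA⟩, h.2⟩⟩

/-- Inside a `3`-cell `X`, an edge leaving a `2`-cell `C ⊆ X` is transported along a path in `C`
to an edge of `X` leaving `C`. -/
theorem IsCellComplex.exists_nablaPath (hK : K.IsCellComplex) {n : ℕ} (hf : K.IsRFull n)
    (hn : 2 ≤ n) {A C X : Set V} (hC : C ∈ K.cells 2) (hX : K.IsCell X) (hCX : C ⊆ X)
    (hXA : X ⊆ A) {a b : V} (p : (K.twoSkeletonIn A).graph.Walk a b) (hp : ∀ w ∈ p.support, w ∈ C)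
    {e : Set V} (he : e ∈ K.edgesAtIn a X) (heC : ¬ e ⊆ C) :
    ∃ f ∈ K.edgesAtIn b X, ¬ f ⊆ C ∧ (K.twoSkeletonIn A).NablaPath p e f := by
  induction p generalizing e with
  | nil => exact ⟨e, he, heC, rfl⟩
  | @cons a u b h p ih =>
    rw [SimpleGraph.Walk.support_cons] at hp
    have ha : a ∈ C := hp a List.mem_cons_self
    have hp' : ∀ w ∈ p.support, w ∈ C := fun w hw => hp w (List.mem_cons_of_mem _ hw)
    have hu : u ∈ C := hp' u p.start_mem_support
    have hau : {a, u} ∈ K.cells 1 := (mem_twoSkeletonIn.1 h.2).2.1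
    have hauC : ({a, u} : Set V) ⊆ C := Set.pair_subset ha hu
    have hne : e ≠ {a, u} := fun h => heC (h ▸ hauC)
    obtain ⟨Z, hZ, haZ, hZe⟩ := hK.exists_cell_pair hf hn (hK.subset_vertexSet C ⟨2, hC⟩ ha)
      he.1 ⟨hau, Set.mem_insert _ _⟩ hne
    have heZ : e ⊆ Z := (hZe ▸ Set.mem_insert _ _ : e ∈ K.edgesAtIn a Z).2
    have hauZ : ({a, u} : Set V) ⊆ Z :=
      (hZe ▸ Set.mem_insert_of_mem _ rfl : {a, u} ∈ K.edgesAtIn a Z).2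
    have hZX : Z ⊆ X := by
      refine hK.subset_of_edgesAtIn_subset ⟨2, hZ⟩ hX haZ (hCX ha) ?_
      rw [hZe]
      rintro f (rfl | rfl)
      · exact he.2
      · exact hauC.trans hCX
    have huZ : u ∈ Z := hauZ (Set.mem_insert_of_mem _ rfl)
    obtain ⟨f, hfe, hfZ⟩ := hK.exists_other_edge hf hn hZ
      (e := {a, u}) (v := u) ⟨⟨hau, Set.mem_insert_of_mem _ rfl⟩, hauZ⟩
    have hfZ' : f ∈ K.edgesAtIn u Z := hfZ ▸ Set.mem_insert_of_mem _ rfl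
    -- If $f$ lay in $C$, then $Z$ would have both of its edges at $u$ in $C$, so $e\subset Z\subset
    -- C$.
    have hfC : ¬ f ⊆ C := by
      intro hfC
      refine heC (heZ.trans (hK.subset_of_edgesAtIn_subset ⟨2, hZ⟩ ⟨2, hC⟩ huZ hu ?_))
      rw [hfZ]
      rintro g (rfl | rfl)
      · exact hauC
      · exact hfC
    obtain ⟨g, hg, hgC, hpg⟩ := ih hp' ⟨hfZ'.1, hfZ'.2.trans hZX⟩ hfC
    refine ⟨g, hg, hgC, f, Or.inr ⟨?_, hne, ?_, hfe, Z, ?_, hauZ, heZ, hfZ'.2⟩, hpg⟩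
    · rw [edgesAt_twoSkeletonIn]
      exact ⟨he.1, he.2.trans hXA⟩
    · rw [edgesAt_twoSkeletonIn]
      exact ⟨hfZ'.1, hfZ'.2.trans (hZX.trans hXA)⟩
    · exact mem_twoSkeletonIn.2 ⟨le_rfl, hZ, hZX.trans hXA⟩

/-- The $2$-cell and the leaving edge $e$ span a $3$-cell $X$. Transport around the loop stays among
the edges of $X$ that leave the $2$-cell, and at the base vertex $e$ is the only one. -/
theorem IsCellComplex.isMonodromyFree_twoSkeletonIn (hK : K.IsCellComplex)
    (hc : K.IsCellConnected) {n : ℕ} (hf : K.IsRFull n) (hn : 3 ≤ n) {A : Set V}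
    (hA : K.IsEdgeClosed A) : (K.twoSkeletonIn A).IsMonodromyFree := by
  rintro C hC D hD v l hl e ⟨he, heD⟩
  rw [mem_twoSkeletonIn] at hC
  obtain rfl := ((isComponent_twoSkeletonIn hC.2.2).1 hD).eq_cell hK hc ⟨2, hC.2.1⟩
  rw [edgesAt_twoSkeletonIn] at he
  have hsupp : ∀ w ∈ l.support, w ∈ D := fun w hw => hl.2 ▸ hw
  have hv : v ∈ D := hsupp v l.start_mem_support
  have hDn := hK.ncard_edgesAtIn hf hC.2.1 hv (by norm_num) (by omega)
  have heC : ¬ e ⊆ D := fun h => by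
    have h1 := heD.2
    rw [Set.inter_eq_left.2 h, hc.1 e he.1.1] at h1
    omega
  have h3 : (insert e (K.edgesAtIn v D)).ncard = 3 := by
    rw [Set.ncard_insert_of_notMem (fun h => heC h.2) (hK.edgesAtIn_finite v D), hDn]
  obtain ⟨X, hX, hvX, hXe⟩ := hK.exists_cell hf (hK.subset_vertexSet D ⟨2, hC.2.1⟩ hv)
    (S := insert e (K.edgesAtIn v D)) (Set.insert_subset he.1 fun f hfD => hfD.1)
    (by omega) (by omega)
  have hDX : D ⊆ X := hK.subset_of_edgesAtIn_subset ⟨2, hC.2.1⟩ ⟨_, hX⟩ hv hvX fun f hfD =>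
    (hXe ▸ Set.mem_insert_of_mem _ hfD : f ∈ K.edgesAtIn v X).2
  have hXA : X ⊆ A := by
    refine hA v (hC.2.2 hv) X ⟨_, hX⟩ hvX ?_
    rw [hXe]
    rintro f (rfl | hfD)
    · exact he.2
    · exact hfD.2.trans hC.2.2
  obtain ⟨f, hfX, hfD, hlf⟩ := hK.exists_nablaPath hf (by omega) hC.2.1 ⟨_, hX⟩ hDX hXA l hsupp
    (hXe ▸ Set.mem_insert _ _ : e ∈ K.edgesAtIn v X) heC
  rw [hXe] at hfX
  rcases hfX with rfl | hfX
  · exact hlf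
  · exact absurd hfX.2 hfD

/-! ### Homotopy depends only on edges and two-cells -/

theorem Move.mapLe {v w : V} (h1 : K.cells 1 = J.cells 1) (h2 : K.cells 2 = J.cells 2)
    (hle : K.graph ≤ J.graph) {p q : K.graph.Walk v w} (h : K.Move p q) :
    J.Move (p.mapLe hle) (q.mapLe hle) := by
  have hD : ∀ C D, K.IsComponent C D → J.IsComponent C D := by
    intro C D hD
    have : (J.restrict C).graph = (K.restrict C).graph :=
      graph_congr (by simp only [cells_restrict, h1])
    unfold IsComponent
    rwa [this]
  cases h with
  | cell C D hC hCD p p' hp hl q₁ q₂ =>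
    simp only [SimpleGraph.Walk.mapLe, SimpleGraph.Walk.map_append]
    refine Move.cell C D (h2 ▸ hC) (hD C D hCD) _ _ (hp.mapLe hle) ⟨?_, ?_⟩ _ _
    · have := hl.1.mapLe hle
      simpa [SimpleGraph.Walk.mapLe, SimpleGraph.Walk.map_append] using this
    · rw [← hl.2]
      ext x
      simp
  | edge h q₁ q₂ =>
    simp only [SimpleGraph.Walk.mapLe, SimpleGraph.Walk.map_append, SimpleGraph.Walk.map_cons]
    exact Move.edge (hle h) _ _

theorem IsSimplyConnected.congr (h1 : K.cells 1 = J.cells 1) (h2 : K.cells 2 = J.cells 2)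
    (h : K.IsSimplyConnected) : J.IsSimplyConnected := by
  refine ⟨fun e he => h.1 e (h1 ▸ he), fun v p => ?_⟩
  have hg := graph_congr h1
  have hmap : ∀ {q q' : K.graph.Walk v v}, K.Homotopic q q' →
      J.Homotopic (q.mapLe hg.le) (q'.mapLe hg.le) := by
    intro q q' hq
    induction hq with
    | rel _ _ h => exact .rel _ _ (h.mapLe h1 h2 hg.le)
    | refl _ => exact .refl _
    | symm _ _ _ ih => exact .symm _ _ ih
    | trans _ _ _ _ _ ih ih' => exact .trans _ _ _ ih ih'
  have := hmap (h.2 v (p.mapLe hg.ge))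
  rwa [show (p.mapLe hg.ge).mapLe hg.le = p by
    simp only [SimpleGraph.Walk.mapLe, SimpleGraph.Walk.map_map]
    exact SimpleGraph.Walk.map_id p] at this

/-! ### Rigidity of regular full subcomplexes -/

/-- Fullness of $J$ provides a $2$-cell of $J$ through $e$ and $f$, and $K$ has only one such
$2$-cell. -/
theorem two_cell_mem_of_isSub {n : ℕ} (hK : K.IsCellComplex) (hf : K.IsRFull n) (hn : 2 ≤ n)
    (hJ : J.IsCellComplex) (hJK : J.IsSub K) (hJf : J.IsFull) {C e f : Set V} {w : V}
    (hC : C ∈ K.cells 2) (he : e ∈ J.edgesAt w) (hfe : f ∈ J.edgesAt w) (hne : e ≠ f)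
    (heC : e ⊆ C) (hfC : f ⊆ C) : C ∈ J.cells 2 := by
  have hw : w ∈ J.vertexSet := hJ.subset_vertexSet e ⟨1, he.1⟩ he.2
  obtain ⟨C', hC', hwC', hC'e⟩ := hJ.exists_cell_pair hJf le_rfl hw he hfe hne
  have heC' : e ⊆ C' := (hC'e ▸ Set.mem_insert _ _ : e ∈ J.edgesAtIn w C').2
  have hfC' : f ⊆ C' := (hC'e ▸ Set.mem_insert_of_mem _ rfl : f ∈ J.edgesAtIn w C').2
  have heK : e ∈ K.edgesAtIn w C := ⟨⟨hJK 1 he.1, he.2⟩, heC⟩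
  have hfK : f ∈ K.edgesAtIn w C := ⟨⟨hJK 1 hfe.1, hfe.2⟩, hfC⟩
  obtain ⟨g, hg, hCg⟩ := hK.exists_other_edge hf hn hC heK
  have hfg : f = g := by
    rw [hCg] at hfK
    exact hfK.resolve_left hne.symm
  subst hfg
  rwa [hK.eq_of_subset hC (hJK 2 hC') (hK.subset_of_edgesAtIn_subset ⟨2, hC⟩ ⟨2, hJK 2 hC'⟩
    (heC he.2) hwC' ?_)]
  rw [hCg]
  rintro g (rfl | rfl)
  · exact heC'
  · exact hfC'

/-- If the edges of the regular full subcomplex `J` at `w` are those of the cell `x`, then the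
same is true at the neighbours of `w` in `J`. -/
theorem edgesAt_eq_of_adj {n r : ℕ} (hK : K.IsCellComplex) (hf : K.IsRFull n) (hr : 2 ≤ r)
    (hrn : r ≤ n) (hJ : J.IsCellComplex) (hJK : J.IsSub K) (hJf : J.IsFull)
    (hJr : J.IsRegular r) {x : Set V} (hx : x ∈ K.cells r) {w u : V} (hwu : J.graph.Adj w u)
    (h : J.edgesAt w = K.edgesAtIn w x) : u ∈ x ∧ J.edgesAt u = K.edgesAtIn u x := by
  have hew : ({w, u} : Set V) ∈ J.edgesAt w := ⟨hwu.2, Set.mem_insert _ _⟩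
  have heu : ({w, u} : Set V) ∈ J.edgesAt u := ⟨hwu.2, Set.mem_insert_of_mem _ rfl⟩
  have hex : ({w, u} : Set V) ⊆ x := (h ▸ hew : {w, u} ∈ K.edgesAtIn w x).2
  have hwx : w ∈ x := hex hew.2
  have hux : u ∈ x := hex heu.2
  have huJ : u ∈ J.vertexSet := hJ.subset_vertexSet _ ⟨1, hwu.2⟩ heu.2
  -- The $2$-cell spanned by $g$ and $\{w,u\}$ lies in $x$, so both its edges at $w$ belong to $J$,
  -- and with them the $2$-cell. Its second edge at $u$ in $J$ must be $g$. Equality then follows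
  -- since both sides have $r$ elements.
  have hsub : K.edgesAtIn u x ⊆ J.edgesAt u := by
    intro g hg
    by_cases hge : g = {w, u}
    · rwa [hge]
    · obtain ⟨C, hC, huC, hCe⟩ := hK.exists_cell_pair hf (by omega)
        (hK.subset_vertexSet x ⟨r, hx⟩ hux) ⟨hJK 1 hwu.2, heu.2⟩ hg.1 (Ne.symm hge)
      have heC : ({w, u} : Set V) ⊆ C := (hCe ▸ Set.mem_insert _ _ : {w, u} ∈ K.edgesAtIn u C).2
      have hCx : C ⊆ x := by
        refine hK.subset_of_edgesAtIn_subset ⟨2, hC⟩ ⟨r, hx⟩ huC hux ?_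
        rw [hCe]
        rintro f (rfl | rfl)
        · exact hex
        · exact hg.2
      obtain ⟨f, hfe, hCf⟩ := hK.exists_other_edge hf (by omega) hC
        (e := {w, u}) (v := w) ⟨⟨hJK 1 hwu.2, hew.2⟩, heC⟩
      have hfC : f ∈ K.edgesAtIn w C := hCf ▸ Set.mem_insert_of_mem _ rfl
      have hfJ : f ∈ J.edgesAt w := h ▸ edgesAtIn_mono K w hCx hfC
      have hCJ := two_cell_mem_of_isSub hK hf (by omega) hJ hJK hJf hC hew hfJ hfe.symm heC hfC.2
      obtain ⟨g', hg', hCg'⟩ := hJ.exists_other_edge hJf le_rfl hCJ (v := u) ⟨heu, heC⟩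
      have hg'J : g' ∈ J.edgesAtIn u C := hCg' ▸ Set.mem_insert_of_mem _ rfl
      have hg'K : g' ∈ K.edgesAtIn u C := ⟨⟨hJK 1 hg'J.1.1, hg'J.1.2⟩, hg'J.2⟩
      rw [hCe] at hg'K
      obtain rfl := hg'K.resolve_left hg'
      exact hg'J.1
  refine ⟨hux, (Set.eq_of_subset_of_ncard_le hsub ?_ (hJ.edgesAt_finite u)).symm⟩
  rw [hK.ncard_edgesAtIn hf hx hux (by omega) hrn, Set.ncard, hJr.2 u huJ]
  simp

/-- Paths in $J$ spread the agreement of edges to all its vertices, so these lie in $x$. A path in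
$x$ then never leaves $J$, which gives the other inclusion. -/
theorem vertexSet_eq_of_edgesAt_eq {n r : ℕ} (hK : K.IsCellComplex) (hc : K.IsCellConnected)
    (hf : K.IsRFull n) (hr : 2 ≤ r)
    (hrn : r ≤ n) (hJ : J.IsCellComplex) (hJK : J.IsSub K) (hJf : J.IsFull)
    (hJr : J.IsRegular r) (hJc : J.IsConnected) {x : Set V} (hx : x ∈ K.cells r) {v : V}
    (hvJ : v ∈ J.vertexSet) (hvx : v ∈ x)
    (h : J.edgesAt v = K.edgesAtIn v x) : J.vertexSet = x := by
  have key : ∀ {a b : V}, J.graph.Walk a b → a ∈ x → J.edgesAt a = K.edgesAtIn a x →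
      b ∈ x ∧ J.edgesAt b = K.edgesAtIn b x := by
    intro a b p
    induction p with
    | nil => exact fun ha h => ⟨ha, h⟩
    | cons hadj p ih =>
      intro _ h
      obtain ⟨hu, h'⟩ := edgesAt_eq_of_adj hK hf hr hrn hJ hJK hJf hJr hx hadj h
      exact ih hu h'
  have hall : ∀ w ∈ J.vertexSet, w ∈ x ∧ J.edgesAt w = K.edgesAtIn w x := fun w hw => by
    obtain ⟨p⟩ := hJc.2 v hvJ w hw
    exact key p hvx h
  refine Set.Subset.antisymm (fun w hw => (hall w hw).1) fun w hw => ?_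
  have hmem : ∀ w ∈ x, w ∈ (K.restrict x).vertexSet := fun w hw =>
    ⟨hK.singleton_mem ⟨r, hx⟩ hw, Set.singleton_subset_iff.2 hw⟩
  obtain ⟨p⟩ := (hc.2 x ⟨r, hx⟩).2 v (hmem v hvx) w (hmem w hw)
  clear h
  induction p with
  | nil => exact hvJ
  | @cons a u b hadj p ih =>
    have hau : {a, u} ∈ J.edgesAt a := by
      rw [(hall a hvJ).2]
      exact ⟨⟨hadj.2.1, Set.mem_insert _ _⟩, hadj.2.2⟩
    have hu : u ∈ J.vertexSet := hJ.subset_vertexSet _ ⟨1, hau.1⟩ (Set.mem_insert_of_mem _ rfl)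
    exact ih hu (hall u hu).1 hw

/-! ### Induced cells and the ambient complex -/

theorem rank_twoSkeletonIn (hK : K.IsCellComplex) {x : Set V} {r : ℕ} (hx : x ∈ K.cells r)
    (hr : 2 ≤ r) {A : Set V} (hA : x ⊆ A) : (K.twoSkeletonIn A).rank = 2 := by
  obtain ⟨v, hv⟩ := hK.nonempty x ⟨r, hx⟩
  obtain ⟨C, hC, -, hCx⟩ := hK.exists_between (hK.singleton_mem ⟨r, hx⟩ hv) hx
    (Set.singleton_subset_iff.2 hv) (Nat.zero_le 2) hr
  refine rank_eq_of_forall ⟨C, mem_twoSkeletonIn.2 ⟨le_rfl, hC, hCx.trans hA⟩⟩ fun s hs => ?_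
  ext y
  simp [mem_twoSkeletonIn, hs]

theorem isInduced_twoSkeletonIn (hK : K.IsCellComplex) (hc : K.IsCellConnected)
    (hs : K.IsSimple) (hR : 3 ≤ K.rank) {x : Set V} {r : ℕ} (hx : x ∈ K.cells r) (hr : 2 ≤ r)
    (heven : K.IsEven) {v : V} (hv : v ∈ x) :
    (K.skeleton 2).IsInduced v (K.edgesAtIn v x) (K.twoSkeletonIn x) ∧
      (K.twoSkeletonIn x).IsRegular r := by
  have hf := hs.2 (by omega)
  have hrR := hK.le_rank hx
  have hreg : (K.twoSkeletonIn x).IsRegular r := by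
    refine ⟨(twoSkeletonIn_isSub x).isGraphBased hc.1, fun w hw => ?_⟩
    rw [vertexSet_twoSkeletonIn] at hw
    rw [edgesAt_twoSkeletonIn, ← (hK.edgesAtIn_finite w x).cast_ncard_eq,
      hK.ncard_edgesAtIn hf hx hw.2 (by omega) hrR]
  have hvK := hK.subset_vertexSet x ⟨r, hx⟩ hv
  have hS := hK.ncard_edgesAtIn hf hx hv (by omega) hrR
  refine ⟨⟨?_, ?_, ?_, hK.twoSkeletonIn x, twoSkeletonIn_isSub_skeleton x,
    rank_twoSkeletonIn hK hx hr subset_rfl, hS.symm ▸ hreg,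
    ⟨(hc.2 x ⟨r, hx⟩).twoSkeletonIn, hc.twoSkeletonIn x⟩, heven.twoSkeletonIn x,
    hf.isFull_twoSkeletonIn (by omega) (hK.isEdgeClosed ⟨r, hx⟩),
    hK.isMonodromyFree_twoSkeletonIn hc hf hR (hK.isEdgeClosed ⟨r, hx⟩), ?_⟩, hreg⟩
  · simpa [vertexSet, cells_skeleton] using hvK
  · rw [edgesAt_skeleton_two]
    -- Properness: $x$ has $r\le R$ edges at $v$, while $v$ has degree $R+1$.
    refine lt_of_le_of_ne (fun e he => he.1) fun h => ?_
    have := hK.ncard_edgesAt_of_isSimple hs (by omega) hvK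
    rw [← h, hS] at this
    omega
  · rw [← (hK.edgesAtIn_finite v x).cast_ncard_eq, hS]
    exact_mod_cast hr
  · rw [edgesAt_skeleton_two, ← edgesAt_twoSkeletonIn]
    ext e
    exact ⟨fun h => ⟨h.1, h.2.2⟩, fun h => ⟨h.1, (twoSkeletonIn_isSub x) 1 h.1, h.2⟩⟩

theorem inducedCells_skeleton_two (hK : K.IsCellComplex) (hc : K.IsCellConnected)
    (hs : K.IsSimple) (hR : 3 ≤ K.rank) (heven : K.IsEven) {r : ℕ} (hr : 2 ≤ r) :
    (K.skeleton 2).inducedCells r = K.cells r := by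
  have hf := hs.2 (by omega)
  ext x
  constructor
  · rintro ⟨v, S, J, hJ, hJr, rfl⟩
    have hJK : J.IsSub K := fun r x hx => K.skeleton_isSub 2 r (hJ.isSub r hx)
    have hvK : v ∈ K.vertexSet := K.skeleton_isSub 2 0 hJ.vertex
    have hSK : S ⊂ K.edgesAt v := by
      rw [← edgesAt_skeleton_two]
      exact hJ.ssubset
    have hSJ : J.edgesAt v = S := by
      rw [← hJ.edges_eq]
      ext e
      exact ⟨fun h => ⟨h.1, hJ.isSub 1 h.1, h.2⟩, fun h => ⟨h.1, h.2.2⟩⟩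
    have hSne : S.Nonempty := by
      rw [← Set.encard_ne_zero]
      intro h
      have := hJ.two_le
      rw [h] at this
      norm_num at this
    have hvJ : v ∈ J.vertexSet := by
      obtain ⟨e, he⟩ := hSne
      rw [← hSJ] at he
      exact hJ.isCellComplex.subset_vertexSet e ⟨1, he.1⟩ he.2
    have hSr : S.ncard = r := by
      rw [← hSJ, Set.ncard, hJr.2 v hvJ]
      simp
    -- As $S$ is a proper subset of $R+1$ edges, $|S|\le R$, so fullness applies and $S$ spans a
    -- cell.
    have hlt := Set.ncard_lt_ncard hSK (hK.edgesAt_finite v)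
    rw [hK.ncard_edgesAt_of_isSimple hs (by omega) hvK] at hlt
    obtain ⟨x, hx, hvx, hxS⟩ := hK.exists_cell hf hvK hSK.subset (by omega) (by omega)
    rw [hSr] at hx
    rwa [vertexSet_eq_of_edgesAt_eq hK hc hf hr (by omega) hJ.isCellComplex hJK hJ.isFull hJr
      hJ.isLocal.1 hx hvJ hvx (hSJ.trans hxS.symm)]
  · intro hx
    obtain ⟨v, hv⟩ := hK.nonempty x ⟨r, hx⟩
    obtain ⟨h, hreg⟩ := isInduced_twoSkeletonIn hK hc hs hR hx hr heven hv
    refine ⟨v, _, _, h, hreg, ?_⟩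
    rw [vertexSet_twoSkeletonIn, Set.inter_eq_right.2 (hK.subset_vertexSet x ⟨r, hx⟩)]

theorem isReconstructible_skeleton_two (hK : K.IsCellComplex) (hlocal : K.IsLocal)
    (heven : K.IsEven) (hsc : K.IsSimplyConnected) (hs : K.IsSimple) (hR : 3 ≤ K.rank) :
    (K.skeleton 2).IsReconstructible := by
  have hf := hs.2 (by omega)
  have hu := K.twoSkeletonIn_univ
  obtain ⟨x, hx⟩ := hK.cells_nonempty_of_le_rank (k := 1) (by omega)
  refine ⟨hu ▸ hK.twoSkeletonIn _, hu ▸ rank_twoSkeletonIn hK hx le_rfl x.subset_univ,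
    ⟨hlocal.1.congr (K.cells_skeleton (by norm_num)) (K.cells_skeleton (by norm_num)),
      hu ▸ hlocal.2.twoSkeletonIn _⟩, hu ▸ heven.twoSkeletonIn _,
    hu ▸ hf.isFull_twoSkeletonIn (by omega) isEdgeClosed_univ,
    hu ▸ hK.isMonodromyFree_twoSkeletonIn hlocal.2 hf hR isEdgeClosed_univ,
    hsc.congr (K.cells_skeleton (by norm_num)).symm (K.cells_skeleton le_rfl).symm, ?_⟩
  intro r hr
  rw [inducedCells_skeleton_two hK hlocal.2 hs hR heven hr]
  intro y hy z hz
  refine (hK.inter y z ⟨r, hy⟩ ⟨r, hz⟩).imp_right fun h => (hlocal.2.2 _ h).congr ?_ ?_ <;>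
  · ext x
    simp [cells_restrict, cells_skeleton]

theorem ambient_skeleton_two (hK : K.IsCellComplex) (hc : K.IsCellConnected)
    (heven : K.IsEven) (hs : K.IsSimple) (hR : 3 ≤ K.rank) : (K.skeleton 2).ambient = K := by
  ext1
  funext r
  by_cases hr : r ≤ 2
  · simp [ambient, hr, cells_skeleton]
  · simp only [ambient, if_neg hr]
    exact inducedCells_skeleton_two hK hc hs hR heven (by omega)

/-- Rank $2$ is excluded by counting the $2$-cells on an edge: closedness of $J$ would give two,
whereas $K$ has as many as its rank, at least three. -/
theorem three_le_rank_of_skeleton_two_eq (hK : K.IsCellComplex) (hs : K.IsSimple)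
    (hR : 3 ≤ K.rank) (hJ : J.IsCellComplex) (hJs : J.IsSimple)
    (h : J.skeleton 2 = K.skeleton 2) : 3 ≤ J.rank := by
  have hcells : ∀ r ≤ 2, J.cells r = K.cells r := fun r hr => by
    rw [← J.cells_skeleton hr, h, K.cells_skeleton hr]
  obtain ⟨x, hx⟩ := hK.cells_nonempty_of_le_rank (k := 1) (by omega)
  have h2 : 2 ≤ J.rank := hJ.le_rank (x := x) (hcells 2 le_rfl ▸ hx)
  by_contra! hlt
  have hJ2 : J.rank = 2 := by omega
  obtain ⟨e, he⟩ := hK.cells_nonempty_of_le_rank (k := 0) (by omega)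
  obtain ⟨v, hv⟩ := hK.nonempty e ⟨1, he⟩
  have h3 := hK.ncard_cofaces (hs.2 (by omega)) he hv le_rfl (by omega)
  rw [hK.ncard_edgesAt_of_isSimple hs (by omega) (hK.subset_vertexSet e ⟨1, he⟩ hv)] at h3
  have h4 := hJs.1.2 1 hJ2.symm e (hcells 1 (by norm_num) ▸ he)
  rw [hcells 2 le_rfl] at h4
  simp only [Nat.reduceAdd, zero_add] at h3 h4
  omega

end RankedFamily

theorem mainTheorem5 {V : Type*} (L : RankedFamily V) (hcc : L.IsCellComplex)
    (hlocal : L.IsLocal) (heven : L.IsEven) (hsc : L.IsSimplyConnected) (hsimple : L.IsSimple)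
    (hrank : 3 ≤ L.rank) :
    (L.skeleton 2).IsReconstructible ∧
    (L.skeleton 2).ambient = L ∧
    ∀ L' : RankedFamily V, L'.IsCellComplex → L'.IsLocal → L'.IsEven → L'.IsSimplyConnected →
      L'.IsSimple → L'.skeleton 2 = L.skeleton 2 → L' = L := by
  refine ⟨RankedFamily.isReconstructible_skeleton_two hcc hlocal heven hsc hsimple hrank,
    RankedFamily.ambient_skeleton_two hcc hlocal.2 heven hsimple hrank, ?_⟩
  intro L' hcc' hlocal' heven' _ hsimple' h
  rw [← RankedFamily.ambient_skeleton_two hcc hlocal.2 heven hsimple hrank, ← h,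
    RankedFamily.ambient_skeleton_two hcc' hlocal'.2 heven' hsimple'
      (RankedFamily.three_le_rank_of_skeleton_two_eq hcc hsimple hrank hcc' hsimple' h)]
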